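/- Let $\Delta\in\mathbb N$ and $c>0$ be constants, and let $\epsilon\in[0,1/4]$. Let $n\ge 2$ and let $\mathcal G=\{G^{(t)}\}_{t=1}^\infty$ be a sequence of (undirected, simple) graphs on the same vertex set $V$ with $|V|=n$, such that each $G^{(t)}$ is regular of degree at most $\Delta$ (the degree may depend on $t$) and $$|E_{G^{(t)}}(A,V\setminus A)|\ \ge\ c\,|A|^{\frac12+\epsilon}\qquad\text{for every } A\subseteq V \text{ with } 1\le |A|\le n/2 .$$ Consider the lazy random walk on $\mathcal G$: in the $t$-th step ($t\ge1$) it stays where it is with probability $1/2$ and otherwise moves to a uniformly random neighbour in $G^{(t)}$. Let $p^{[0,t]}_{u,v}$ be the probability that the walk started at $u$ at time $0$ is at $v$ at time $t$, let $\pi$ be the uniform distribution on $V$, let $$t_{\mathsf{mix}}(\mathcal G)=\min\Bigl\{t:\ \Bigl(\sum_{v}\pi(v)\bigl(p^{[0,t]}_{u,v}/\pi(v)-1\bigr)^2\Bigr)^{1/2}\le \tfrac13\ \text{ for all } u\in V\Bigr\},$$ and let $t_{\mathsf{hit}}(\mathcal G)$ be the maximum over $u,v\in V$ of the expected first time $t\ge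 0$ at which the walk started at $u$ is at $v$. Then: 1. $t_{\mathsf{mix}}(\mathcal G)\le C\,n^{1-2\epsilon}$; 2. $\bigl|p^{[0,t]}_{u,v}-\frac1n\bigr|\le C\,t^{-(1+2\epsilon)}$ for all $t\ge1$ and all $u,v\in V$; 3. $t_{\mathsf{hit}}(\mathcal G)\le C_\epsilon\, n$ if $\epsilon>0$, and $t_{\mathsf{hit}}(\mathcal G)\le C\, n\log n$ if $\epsilon=0$. Here $C>0$ depends only on $\Delta$ and $c$, and $C_\epsilon>0$ only on $\Delta$, $c$ and $\epsilon$. -/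

import Mathlib

open scoped ENNReal
open MeasureTheory

namespace EvolvingGraph

variable {V : Type*} [Fintype V]

open Classical in
/-- Transition matrix of the lazy random walk on `G`: stay put with probability `1/2`, otherwise
move to a uniformly random neighbour. -/
noncomputable def lazyMatrix (G : SimpleGraph V) : Matrix V V ℝ :=
  Matrix.of fun u v =>
    if u = v then 1 / 2 else if G.Adj u v then 1 / (2 * (G.degree u : ℝ)) else 0

open Classical in
/-- `transProb G t u v` is the probability that the lazy walk on the sequence `G`, started at `u`
at time `0`, is at `v` at time `t`. The step from time `i` to time `i + 1` uses the graph `G i`,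
so `G 0, G 1, …` are the first, second, … graphs of the sequence. -/
noncomputable def transProb (G : ℕ → SimpleGraph V) : ℕ → Matrix V V ℝ
  | 0 => 1
  | t + 1 => transProb G t * lazyMatrix (G t)

/-- The uniform distribution on `V`, which is the stationary distribution of the lazy walk on
every connected regular graph with vertex set `V`. -/
noncomputable def unif (V : Type*) [Fintype V] : V → ℝ :=
  fun _ => 1 / (Fintype.card V : ℝ)

/-- The `ℓ²(π)` distance `‖p / π - 1‖_{2,π}` of the likelihood ratio `p / π` from `1`. -/
noncomputable def l2Dist (π p : V → ℝ) : ℝ :=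
  Real.sqrt (∑ v, (p v / π v - 1) ^ 2 * π v)

/-- The times at which the walk is `1/3`-close to `π` in `ℓ²(π)`, from every starting vertex. -/
def mixedTimes (π : V → ℝ) (G : ℕ → SimpleGraph V) : Set ℕ :=
  {t | ∀ u, l2Dist π (transProb G t u) ≤ 1 / 3}

/-- The `ℓ²` mixing time: the least element of `mixedTimes π G` (meaningful when that set is
nonempty). -/
noncomputable def mixingTime (π : V → ℝ) (G : ℕ → SimpleGraph V) : ℕ :=
  sInf (mixedTimes π G)

/-- `X` is a lazy random walk on the sequence `G` started at `u`: a process whose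
finite-dimensional laws are those of the time-inhomogeneous Markov chain with transition matrices
`lazyMatrix (G 0), lazyMatrix (G 1), …` and initial state `u`. -/
structure IsLazyWalk (G : ℕ → SimpleGraph V) (u : V) {Ω : Type*} [MeasurableSpace Ω]
    (μ : Measure Ω) (X : ℕ → Ω → V) : Prop where
  measurableSet_eq : ∀ t v, MeasurableSet {ω | X t ω = v}
  start : ∀ᵐ ω ∂μ, X 0 ω = u
  path_law : ∀ (t : ℕ) (x : ℕ → V), x 0 = u →
    μ {ω | ∀ i ≤ t, X i ω = x i} =
      ENNReal.ofReal (∏ i ∈ Finset.range t, lazyMatrix (G i) (x i) (x (i + 1)))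

/-- The first time `t ≥ 0` at which the process `X` is at `v`; it is `∞` if there is none. -/
noncomputable def hitTime {Ω : Type*} (X : ℕ → Ω → V) (v : V) (ω : Ω) : ℝ≥0∞ :=
  ⨅ (t : ℕ) (_ : X t ω = v), (t : ℝ≥0∞)

open Classical in
/-- Every graph of the sequence is regular, of degree at most `Δ`. The degree may change from
graph to graph. -/
def IsRegularBounded (Δ : ℕ) (G : ℕ → SimpleGraph V) : Prop :=
  ∀ t, ∃ d ≤ Δ, (G t).IsRegularOfDegree d

open Classical in
/-- Every graph of the sequence satisfies `|E(A, V ∖ A)| ≥ c |A|^(1/2 + ε)` for all sets `A` of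
vertices with `1 ≤ |A| ≤ |V| / 2`. -/
def IsIsoperimetric (c ε : ℝ) (G : ℕ → SimpleGraph V) : Prop :=
  ∀ t, ∀ A : Finset V, 1 ≤ A.card → 2 * A.card ≤ Fintype.card V →
    c * (A.card : ℝ) ^ (1 / 2 + ε) ≤ (((G t).interedges A Aᶜ).card : ℝ)

end EvolvingGraph

/-!
The steps of the walk on a connected regular graph are symmetric stochastic matrices `P` with
diagonal entries `1/2`, and the isoperimetric hypothesis says that `P` puts weight at least
`κ |A| ^ (1/2 + ε)` between `A` and its complement. Nothing else about the graphs is used, and both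
properties survive shifting and reversing time (`IsGood`).

*Decay of the `ℓ²` distance.* By `coarea` and Cauchy–Schwarz the profile gives a Cheeger
inequality for functions of small support (`cheeger`). A probability vector is split at its median
and the larger half `φ`, which has `‖φ‖₁ ≤ 1`, is truncated at level `‖φ‖₂² / 4`. This leaves half
of `‖φ‖₂²` on a support of size at most `4 / ‖φ‖₂²`, and yields a Nash inequality (`nash_prob`).
Laziness makes one step lower the squared `ℓ²` distance `E` from uniform by at least the Dirichlet
form, so that `E_{t+1} ≤ E_t - c E_t ^ (1 + δ)` with `δ = 1 - 2 ε` (`energy_step`), whence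
`E_t ^ δ ≤ C / t` (`energy_decay`). The mixing time bound is the case `E_t ≤ 1 / (9 n)`. Splitting
`[0, t]` in the middle, and reversing time on the second half, turns the bound on `E` into the
pointwise bound `C t ^ (-1 / δ) ≤ C t ^ (-(1 + 2 ε))` (`abs_transProb_sub_le`).

*Hitting times.* By the pointwise bound, a time window of length `L` of order `n` contains at least
`1/2` expected visits to `v` whatever the starting vertex, while a walk started at `v` makes at most
`S = O(1 + ∑_{t ≤ L} t ^ (-(1 + 2 ε)))` of them. Hence `v` is hit in each window with probability at
least `1 / (2 S)` (`expVisits_le`), and the expected hitting time is at most `2 L S`. The sum in `S`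
is bounded for `ε > 0` and is `O(log n)` for `ε = 0`.
-/

namespace EvolvingGraph

section Analysis

variable {V : Type*} [Fintype V]

/-! ### Lazy symmetric stochastic matrices -/

/-- A symmetric stochastic matrix whose diagonal entries are at least `1/2`. -/
structure IsLazySymm (P : Matrix V V ℝ) : Prop where
  symm : ∀ x y, P x y = P y x
  nonneg : ∀ x y, 0 ≤ P x y
  sum_row : ∀ x, ∑ y, P x y = 1
  half_le_diag : ∀ x, 1 / 2 ≤ P x x

/-- The isoperimetric profile of `P` is at least `κ |A|^s`: the total weight that `P` puts between
`A` and its complement, for every `A` with `1 ≤ |A| ≤ |V| / 2`. -/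
def HasProfile [DecidableEq V] (κ s : ℝ) (P : Matrix V V ℝ) : Prop :=
  ∀ A : Finset V, 1 ≤ A.card → 2 * A.card ≤ Fintype.card V →
    κ * (A.card : ℝ) ^ s ≤ ∑ x ∈ A, ∑ y ∈ Aᶜ, P x y

/-- Co-area inequality: a function is the sum of multiples of indicators of its superlevel sets, so
a lower bound for the boundary of all subsets of its support bounds its total variation. -/
lemma coarea [DecidableEq V] {w : V → V → ℝ} (hs : ∀ x y, w x y = w y x) (h : ℝ) :
    ∀ (k : ℕ) (φ : V → ℝ), (Finset.univ.filter fun x => φ x ≠ 0).card ≤ k → (∀ x, 0 ≤ φ x) →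
      (∀ A : Finset V, (∀ x ∈ A, φ x ≠ 0) → A.Nonempty →
        h * A.card ≤ ∑ x ∈ A, ∑ y ∈ Aᶜ, w x y) →
      2 * h * ∑ x, φ x ≤ ∑ x, ∑ y, w x y * |φ x - φ y| := by
  intro k
  induction k with
  | zero =>
    intro φ hk _ _
    have h0 : ∀ x, φ x = 0 := by
      intro x
      by_contra hx
      have : x ∈ Finset.univ.filter fun x => φ x ≠ 0 := by simp [hx]
      have := Finset.card_pos.2 ⟨x, this⟩
      omega
    simp [h0]
  | succ k ih =>
    intro φ hk hφ hcut
    set A := Finset.univ.filter fun x => φ x ≠ 0 with hA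
    rcases A.eq_empty_or_nonempty with hAe | hAn
    · exact ih φ (by rw [← hA, hAe]; simp) hφ hcut
    -- peel off the lowest layer `m · 1_A`
    obtain ⟨x₀, hx₀, hmin⟩ := A.exists_min_image φ hAn
    set m := φ x₀ with hm
    have hmem : ∀ x, x ∈ A ↔ φ x ≠ 0 := by intro x; simp [hA]
    have hm0 : 0 ≤ m := hφ x₀
    let i : V → ℝ := fun x => if x ∈ A then 1 else 0
    let ψ : V → ℝ := fun x => φ x - m * i x
    have hψ0 : ∀ x, φ x = 0 → ψ x = 0 := by
      intro x hx
      have : x ∉ A := by simp [hmem, hx]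
      simp [ψ, i, this, hx]
    have hψ : ∀ x, 0 ≤ ψ x := by
      intro x
      by_cases hx : x ∈ A
      · simpa [ψ, i, hx] using hmin x hx
      · simpa [ψ, i, hx] using hφ x
    have hlt : (Finset.univ.filter fun x => ψ x ≠ 0).card < A.card := by
      apply Finset.card_lt_card
      refine Finset.ssubset_iff_subset_ne.2 ⟨?_, ?_⟩
      · intro x hx
        rw [hmem]
        intro h0
        exact (Finset.mem_filter.1 hx).2 (hψ0 x h0)
      · intro he
        rw [← he] at hx₀
        apply (Finset.mem_filter.1 hx₀).2
        have : x₀ ∈ A := by rw [← he]; exact hx₀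
        simp [ψ, i, this, hm]
    have hI := ih ψ (by omega) hψ (fun B hB => hcut B fun x hx h0 => hB x hx (hψ0 x h0))
    have hpt : ∀ x y, |φ x - φ y| = |ψ x - ψ y| + m * |i x - i y| := by
      intro x y
      by_cases hx : x ∈ A <;> by_cases hy : y ∈ A
      · simp [ψ, i, hx, hy]
      · have h1 := hmin x hx
        have h2 : φ y = 0 := by simpa [hmem] using hy
        simp only [ψ, i, hx, hy, h2, if_true, if_false]
        norm_num
        rw [abs_of_nonneg (hφ x), abs_of_nonneg (by linarith)]; ring
      · have h1 := hmin y hy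
        have h2 : φ x = 0 := by simpa [hmem] using hx
        simp only [ψ, i, hx, hy, h2, if_true, if_false]
        norm_num
        rw [abs_of_nonneg (hφ y), abs_of_nonpos (by linarith)]; ring
      · simp [ψ, i, hx, hy]
    have hcutA : ∑ x, ∑ y, w x y * |i x - i y| = 2 * ∑ x ∈ A, ∑ y ∈ Aᶜ, w x y := by
      have e1 : ∀ x y, w x y * |i x - i y| =
          (if x ∈ A then (if y ∈ Aᶜ then w x y else 0) else 0) +
          (if y ∈ A then (if x ∈ Aᶜ then w y x else 0) else 0) := by
        intro x y
        by_cases hx : x ∈ A <;> by_cases hy : y ∈ A <;> simp [i, hx, hy, hs x y]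
      have e2 : ∑ x, ∑ y, (if x ∈ A then (if y ∈ Aᶜ then w x y else 0) else 0)
          = ∑ x ∈ A, ∑ y ∈ Aᶜ, w x y := by
        rw [← Finset.sum_filter_add_sum_filter_not Finset.univ (fun x => x ∈ A)]
        rw [Finset.sum_eq_zero (s := Finset.univ.filter fun x => x ∉ A), add_zero]
        · rw [Finset.filter_univ_mem]
          refine Finset.sum_congr rfl fun x hx => ?_
          rw [← Finset.sum_filter_add_sum_filter_not Finset.univ (fun y => y ∈ Aᶜ)]
          rw [Finset.sum_eq_zero (s := Finset.univ.filter fun y => y ∉ Aᶜ), add_zero]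
          · rw [Finset.filter_univ_mem]
            refine Finset.sum_congr rfl fun y hy => by simp [hx, hy]
          · intro y hy
            simp [(Finset.mem_filter.1 hy).2]
        · intro x hx
          simp [(Finset.mem_filter.1 hx).2]
      simp_rw [e1, Finset.sum_add_distrib]
      rw [Finset.sum_comm (f := fun x y => if y ∈ A then (if x ∈ Aᶜ then w y x else 0) else 0), e2]
      ring
    have hsum : ∑ x, φ x = ∑ x, ψ x + m * A.card := by
      simp [ψ, i, Finset.sum_sub_distrib, mul_comm]
    have hsplit : ∑ x, ∑ y, w x y * |φ x - φ y| =
        ∑ x, ∑ y, w x y * |ψ x - ψ y| + m * ∑ x, ∑ y, w x y * |i x - i y| := by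
      simp_rw [hpt, mul_add, Finset.sum_add_distrib, Finset.mul_sum]
      congr 1
      refine Finset.sum_congr rfl fun x _ => Finset.sum_congr rfl fun y _ => by ring
    have hc := hcut A (fun x hx => (hmem x).1 hx) hAn
    rw [hsplit, hsum, hcutA]
    nlinarith [mul_le_mul_of_nonneg_left hc hm0]

/-- Cheeger's inequality for functions whose support has only subsets of large boundary. -/
lemma cheeger [DecidableEq V] {P : Matrix V V ℝ} (hP : IsLazySymm P) {h : ℝ} (hh : 0 ≤ h)
    {g : V → ℝ}
    (hcut : ∀ A : Finset V, (∀ x ∈ A, g x ≠ 0) → A.Nonempty →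
        h * A.card ≤ ∑ x ∈ A, ∑ y ∈ Aᶜ, P x y) :
    h ^ 2 * ∑ x, g x ^ 2 ≤ ∑ x, ∑ y, P x y * (g x - g y) ^ 2 := by
  have hco := coarea hP.symm h _ (fun x => g x ^ 2) le_rfl (fun x => sq_nonneg _)
    (fun A hA => hcut A fun x hx h0 => hA x hx (by simp [h0]))
  set N := ∑ x, g x ^ 2 with hN
  set D := ∑ x, ∑ y, P x y * (g x - g y) ^ 2 with hD
  have hN0 : 0 ≤ N := Finset.sum_nonneg fun x _ => sq_nonneg _
  have hD0 : 0 ≤ D := Finset.sum_nonneg fun x _ => Finset.sum_nonneg fun y _ =>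
    mul_nonneg (hP.nonneg x y) (sq_nonneg _)
  have hr : ∑ x, ∑ y, P x y * g x ^ 2 = N := by
    simp_rw [← Finset.sum_mul, hP.sum_row, one_mul, hN]
  have hl : ∑ x, ∑ y, P x y * g y ^ 2 = N := by
    rw [Finset.sum_comm, ← hr]
    refine Finset.sum_congr rfl fun x _ => Finset.sum_congr rfl fun y _ => by rw [hP.symm]
  have hplus : ∑ x, ∑ y, P x y * (g x + g y) ^ 2 ≤ 4 * N := by
    have : ∑ x, ∑ y, P x y * (g x + g y) ^ 2 ≤
        ∑ x, ∑ y, (2 * (P x y * g x ^ 2) + 2 * (P x y * g y ^ 2)) := by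
      refine Finset.sum_le_sum fun x _ => Finset.sum_le_sum fun y _ => ?_
      nlinarith [mul_nonneg (hP.nonneg x y) (sq_nonneg (g x - g y))]
    simp_rw [Finset.sum_add_distrib, ← Finset.mul_sum, hr, hl] at this
    linarith
  have hcs : (∑ x, ∑ y, P x y * |g x ^ 2 - g y ^ 2|) ^ 2 ≤ D * (4 * N) := by
    refine le_trans ?_ (mul_le_mul_of_nonneg_left hplus hD0)
    rw [hD]
    simp_rw [← Fintype.sum_prod_type']
    have := Finset.sum_mul_sq_le_sq_mul_sq Finset.univ
      (fun z : V × V => Real.sqrt (P z.1 z.2) * |g z.1 - g z.2|)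
      (fun z : V × V => Real.sqrt (P z.1 z.2) * |g z.1 + g z.2|)
    simp_rw [mul_pow, sq_abs, Real.sq_sqrt (hP.nonneg _ _)] at this
    refine le_trans (le_of_eq ?_) this
    congr 1
    refine Finset.sum_congr rfl fun z _ => ?_
    rw [show g z.1 ^ 2 - g z.2 ^ 2 = (g z.1 - g z.2) * (g z.1 + g z.2) by ring, abs_mul]
    nth_rewrite 1 [← Real.mul_self_sqrt (hP.nonneg z.1 z.2)]
    ring
  have hsq : (2 * h * N) ^ 2 ≤ D * (4 * N) :=
    le_trans (pow_le_pow_left₀ (by positivity) hco 2) hcs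
  rcases hN0.eq_or_lt with h0 | h0
  · rw [← h0]; simpa using hD0
  · have : (h ^ 2 * N) * (4 * N) ≤ D * (4 * N) := by nlinarith
    exact le_of_mul_le_mul_right this (by positivity)

/-- One step of a lazy walk decreases the `ℓ²` norm by at least the Dirichlet form, since
`P = (1 + M) / 2` with a symmetric stochastic `M`, whence `P² ≤ P`. -/
lemma sum_sq_step_le [DecidableEq V] {P : Matrix V V ℝ} (hP : IsLazySymm P) (f : V → ℝ) :
    ∑ y, (∑ x, f x * P x y) ^ 2 ≤
      ∑ x, f x ^ 2 - (1 / 2) * ∑ x, ∑ y, P x y * (f x - f y) ^ 2 := by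
  let M : V → V → ℝ := fun x y => 2 * P x y - if x = y then 1 else 0
  have hM0 : ∀ x y, 0 ≤ M x y := by
    intro x y
    by_cases hxy : x = y
    · subst hxy; simp only [M, if_true]; linarith [hP.half_le_diag x]
    · simp only [M, hxy, if_false]; linarith [hP.nonneg x y]
  have hMr : ∀ y, ∑ x, M x y = 1 := by
    intro y
    have : ∑ x, P x y = 1 := by rw [← hP.sum_row y]; exact Finset.sum_congr rfl fun x _ => hP.symm x y
    simp only [M, Finset.sum_sub_distrib, ← Finset.mul_sum, this]
    simp; norm_num
  have hMl : ∀ x, ∑ y, M x y = 1 := by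
    intro x
    simp only [M, Finset.sum_sub_distrib, ← Finset.mul_sum, hP.sum_row]
    simp; norm_num
  have hPf : ∀ y, ∑ x, f x * P x y = (f y + ∑ x, f x * M x y) / 2 := by
    intro y
    have : ∑ x, f x * M x y = 2 * ∑ x, f x * P x y - f y := by
      simp only [M, mul_sub, Finset.sum_sub_distrib, Finset.mul_sum]
      congr 1
      · exact Finset.sum_congr rfl fun x _ => by ring
      · simp
    rw [this]; ring
  have hMsq : ∑ y, (∑ x, f x * M x y) ^ 2 ≤ ∑ x, f x ^ 2 := by
    have h1 : ∀ y, (∑ x, f x * M x y) ^ 2 ≤ ∑ x, M x y * f x ^ 2 := by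
      intro y
      have := (even_two.convexOn_pow (𝕜 := ℝ)).map_sum_le (t := Finset.univ)
        (w := fun x => M x y) (p := f) (fun x _ => hM0 x y) (hMr y) (fun _ _ => Set.mem_univ _)
      simp only [smul_eq_mul] at this
      refine le_trans (le_of_eq ?_) this
      congr 1
      exact Finset.sum_congr rfl fun x _ => by ring
    refine (Finset.sum_le_sum fun y _ => h1 y).trans (le_of_eq ?_)
    rw [Finset.sum_comm]
    simp_rw [← Finset.sum_mul, hMl, one_mul]
  -- `‖P f‖² ≤ ⟨f, P f⟩`
  have hle : ∑ y, (∑ x, f x * P x y) ^ 2 ≤ ∑ y, f y * ∑ x, f x * P x y := by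
    have e : ∑ y, f y * ∑ x, f x * P x y - ∑ y, (∑ x, f x * P x y) ^ 2 =
        (∑ x, f x ^ 2 - ∑ y, (∑ x, f x * M x y) ^ 2) / 4 := by
      rw [← Finset.sum_sub_distrib, ← Finset.sum_sub_distrib, Finset.sum_div]
      refine Finset.sum_congr rfl fun y _ => ?_
      rw [hPf]; ring
    linarith
  refine hle.trans (le_of_eq ?_)
  have h1 : ∑ x, ∑ y, P x y * f x ^ 2 = ∑ x, f x ^ 2 := by
    simp_rw [← Finset.sum_mul, hP.sum_row, one_mul]
  have h2 : ∑ x, ∑ y, P x y * f y ^ 2 = ∑ x, f x ^ 2 := by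
    rw [Finset.sum_comm, ← h1]
    refine Finset.sum_congr rfl fun x _ => Finset.sum_congr rfl fun y _ => by rw [hP.symm]
  have h3 : ∑ y, f y * ∑ x, f x * P x y = ∑ x, ∑ y, P x y * (f x * f y) := by
    rw [Finset.sum_comm]
    refine Finset.sum_congr rfl fun y _ => ?_
    rw [Finset.mul_sum]
    exact Finset.sum_congr rfl fun x _ => by ring
  have h4 : ∑ x, ∑ y, P x y * (f x - f y) ^ 2 =
      ∑ x, ∑ y, P x y * f x ^ 2 - 2 * ∑ x, ∑ y, P x y * (f x * f y) +
        ∑ x, ∑ y, P x y * f y ^ 2 := by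
    simp_rw [Finset.mul_sum, ← Finset.sum_sub_distrib, ← Finset.sum_add_distrib]
    exact Finset.sum_congr rfl fun x _ => Finset.sum_congr rfl fun y _ => by ring
  rw [h4, h1, h2, h3]; ring

/-! ### A Nash inequality from the isoperimetric profile -/

lemma exists_median [Nonempty V] (p : V → ℝ) : ∃ y₀,
    2 * (Finset.univ.filter fun x => p x < p y₀).card ≤ Fintype.card V ∧
    2 * (Finset.univ.filter fun x => p y₀ < p x).card ≤ Fintype.card V := by
  classical
  let S := Finset.univ.filter fun y =>
    2 * (Finset.univ.filter fun x => p x < p y).card ≤ Fintype.card V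
  obtain ⟨a, -, ha⟩ := Finset.univ.exists_min_image p Finset.univ_nonempty
  have hS : S.Nonempty := by
    refine ⟨a, Finset.mem_filter.2 ⟨Finset.mem_univ _, ?_⟩⟩
    rw [Finset.filter_false_of_mem (fun x hx => not_lt.2 (ha x hx))]
    simp
  obtain ⟨y₀, hy₀, hmax⟩ := S.exists_max_image p hS
  refine ⟨y₀, (Finset.mem_filter.1 hy₀).2, ?_⟩
  rcases (Finset.univ.filter fun x => p y₀ < p x).eq_empty_or_nonempty with he | hne
  · rw [he]; simp
  obtain ⟨z, hz, hzmin⟩ := Finset.exists_min_image _ p hne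
  have hzy : p y₀ < p z := (Finset.mem_filter.1 hz).2
  have hzS : z ∉ S := fun h => absurd (hmax z h) (not_le.2 hzy)
  have hzc : Fintype.card V < 2 * (Finset.univ.filter fun x => p x < p z).card := by
    by_contra hcon
    exact hzS (Finset.mem_filter.2 ⟨Finset.mem_univ _, not_lt.1 hcon⟩)
  have heq : (Finset.univ.filter fun x => p x < p z) =
      (Finset.univ.filter fun x => ¬ p y₀ < p x) := by
    ext x
    simp only [Finset.mem_filter, Finset.mem_univ, true_and]
    constructor
    · intro h1 h2
      exact absurd (hzmin x (by simp [h2])) (not_le.2 h1)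
    · intro h1; exact lt_of_le_of_lt (not_lt.1 h1) hzy
  have := Finset.card_filter_add_card_filter_not (s := (Finset.univ : Finset V)) (fun x => p y₀ < p x)
  rw [heq] at hzc
  rw [Finset.card_univ] at this
  omega

/-- Faber–Krahn type bound: truncating `φ` at the level `‖φ‖₂² / 4` keeps half of its `ℓ²` norm
and leaves a support of size at most `4 / ‖φ‖₂²`, where the isoperimetric profile is large. -/
lemma nash_nonneg [DecidableEq V] {P : Matrix V V ℝ} (hP : IsLazySymm P) {κ ε : ℝ} (hκ : 0 ≤ κ)
    (hε : ε ≤ 1 / 4) (hpr : HasProfile κ (1 / 2 + ε) P) {φ : V → ℝ} (hφ : ∀ x, 0 ≤ φ x)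
    (h1 : ∑ x, φ x ≤ 1)
    (hsupp : 2 * (Finset.univ.filter fun x => 0 < φ x).card ≤ Fintype.card V) :
    κ ^ 2 / 2 * ((∑ x, φ x ^ 2) * ((∑ x, φ x ^ 2) / 4) ^ (1 - 2 * ε)) ≤
      ∑ x, ∑ y, P x y * (φ x - φ y) ^ 2 := by
  set N := ∑ x, φ x ^ 2 with hN
  have hD0 : 0 ≤ ∑ x, ∑ y, P x y * (φ x - φ y) ^ 2 :=
    Finset.sum_nonneg fun x _ => Finset.sum_nonneg fun y _ =>
      mul_nonneg (hP.nonneg x y) (sq_nonneg _)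
  have hN0 : 0 ≤ N := Finset.sum_nonneg fun x _ => sq_nonneg _
  rcases hN0.eq_or_lt with h0 | hNpos
  · rw [← h0]; simpa using hD0
  let g : V → ℝ := fun x => max 0 (φ x - N / 4)
  have hgpos : ∀ x, g x ≠ 0 → N / 4 < φ x := by
    intro x hx
    by_contra hcon
    exact hx (max_eq_left (by linarith))
  have hgN : N / 2 ≤ ∑ x, g x ^ 2 := by
    have : ∑ x, (φ x ^ 2 - N / 2 * φ x) ≤ ∑ x, g x ^ 2 := by
      refine Finset.sum_le_sum fun x _ => ?_
      by_cases hx : N / 4 ≤ φ x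
      · have : g x = φ x - N / 4 := max_eq_right (by linarith)
        rw [this]; nlinarith
      · have := hφ x
        push Not at hx
        nlinarith [sq_nonneg (g x)]
    rw [Finset.sum_sub_distrib, ← Finset.mul_sum, ← hN] at this
    nlinarith
  set r := (N / 4) ^ (1 / 2 - ε) with hr
  have hr0 : 0 < r := Real.rpow_pos_of_pos (by linarith) _
  have hch := cheeger hP (h := κ * r) (g := g) (mul_nonneg hκ hr0.le) (by
    intro A hA hAn
    have hAc : (1 : ℕ) ≤ A.card := Finset.card_pos.2 hAn
    have hAφ : ∀ x ∈ A, N / 4 < φ x := fun x hx => hgpos x (hA x hx)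
    have hA2 : 2 * A.card ≤ Fintype.card V := by
      refine le_trans (Nat.mul_le_mul_left 2 (Finset.card_le_card ?_)) hsupp
      intro x hx
      have := hAφ x hx
      simp only [Finset.mem_filter, Finset.mem_univ, true_and]
      linarith
    refine le_trans ?_ (hpr A hAc hA2)
    have hcard : (A.card : ℝ) * (N / 4) ≤ 1 := by
      calc (A.card : ℝ) * (N / 4) = ∑ x ∈ A, (N / 4) := by rw [Finset.sum_const, nsmul_eq_mul]
        _ ≤ ∑ x ∈ A, φ x := Finset.sum_le_sum fun x hx => (hAφ x hx).le
        _ ≤ ∑ x, φ x := Finset.sum_le_sum_of_subset_of_nonneg (Finset.subset_univ _)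
            fun x _ _ => hφ x
        _ ≤ 1 := h1
    have ha : (0 : ℝ) < A.card := by exact_mod_cast hAc
    have e1 : r * (A.card : ℝ) ^ (1 / 2 - ε) ≤ 1 := by
      rw [hr, ← Real.mul_rpow (by linarith) ha.le, mul_comm]
      exact Real.rpow_le_one (by positivity) hcard (by linarith)
    have e2 : (A.card : ℝ) = (A.card : ℝ) ^ (1 / 2 + ε) * (A.card : ℝ) ^ (1 / 2 - ε) := by
      rw [← Real.rpow_add ha]; norm_num
    have e3 : 0 ≤ κ * (A.card : ℝ) ^ (1 / 2 + ε) := mul_nonneg hκ (Real.rpow_nonneg ha.le _)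
    calc κ * r * A.card
        = κ * r * ((A.card : ℝ) ^ (1 / 2 + ε) * (A.card : ℝ) ^ (1 / 2 - ε)) := by rw [← e2]
      _ = κ * (A.card : ℝ) ^ (1 / 2 + ε) * (r * (A.card : ℝ) ^ (1 / 2 - ε)) := by ring
      _ ≤ κ * (A.card : ℝ) ^ (1 / 2 + ε) := mul_le_of_le_one_right e3 e1)
  have hDg : ∑ x, ∑ y, P x y * (g x - g y) ^ 2 ≤ ∑ x, ∑ y, P x y * (φ x - φ y) ^ 2 := by
    refine Finset.sum_le_sum fun x _ => Finset.sum_le_sum fun y _ =>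
      mul_le_mul_of_nonneg_left ?_ (hP.nonneg x y)
    refine sq_le_sq.2 ?_
    have := abs_max_sub_max_le_abs (φ x - N / 4) (φ y - N / 4) 0
    simpa [g, max_comm] using this
  have hr2 : (N / 4) ^ (1 - 2 * ε) = r ^ 2 := by
    rw [hr, ← Real.rpow_natCast, ← Real.rpow_mul (by linarith)]
    congr 1; push_cast; ring
  rw [hr2]
  refine le_trans ?_ (hch.trans hDg)
  have := mul_le_mul_of_nonneg_left hgN (sq_nonneg (κ * r))
  linarith

/-- Nash inequality for probability vectors: split at the median and apply `nash_nonneg` to the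
part with the larger `ℓ²` norm. -/
lemma nash_prob [DecidableEq V] [Nonempty V] {P : Matrix V V ℝ} (hP : IsLazySymm P) {κ ε : ℝ}
    (hκ : 0 ≤ κ) (hε0 : 0 ≤ ε) (hε : ε ≤ 1 / 4) (hpr : HasProfile κ (1 / 2 + ε) P) {p : V → ℝ}
    (hp : ∀ x, 0 ≤ p x) (h1 : ∑ x, p x = 1) :
    κ ^ 2 / 32 * (∑ x, (p x - 1 / Fintype.card V) ^ 2) ^ (1 + (1 - 2 * ε)) ≤
      ∑ x, ∑ y, P x y * (p x - p y) ^ 2 := by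
  obtain ⟨y₀, hlo, hhi⟩ := exists_median p
  set m := p y₀ with hm
  set E := ∑ x, (p x - 1 / Fintype.card V) ^ 2 with hE
  have hE0 : 0 ≤ E := Finset.sum_nonneg fun x _ => sq_nonneg _
  have hn : (0 : ℝ) < Fintype.card V := by exact_mod_cast Fintype.card_pos
  -- centring at the mean minimizes the `ℓ²` norm
  have hEm : E ≤ ∑ x, (p x - m) ^ 2 := by
    have : ∑ x, (p x - m) ^ 2 - E =
        ∑ x, ((2 / Fintype.card V - 2 * m) * p x + (m ^ 2 - (1 / Fintype.card V) ^ 2)) := by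
      rw [hE, ← Finset.sum_sub_distrib]
      exact Finset.sum_congr rfl fun x _ => by ring
    rw [Finset.sum_add_distrib, ← Finset.mul_sum, h1, Finset.sum_const, Finset.card_univ,
      nsmul_eq_mul] at this
    have h2 : (2 / Fintype.card V - 2 * m) * 1 + Fintype.card V * (m ^ 2 - (1 / Fintype.card V) ^ 2)
        = Fintype.card V * (m - 1 / Fintype.card V) ^ 2 := by
      field_simp; ring
    rw [h2] at this
    have : 0 ≤ (Fintype.card V : ℝ) * (m - 1 / Fintype.card V) ^ 2 := by positivity
    linarith
  suffices key : ∃ φ : V → ℝ, (∀ x, 0 ≤ φ x) ∧ ∑ x, φ x ≤ 1 ∧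
      2 * (Finset.univ.filter fun x => 0 < φ x).card ≤ Fintype.card V ∧
      E / 2 ≤ ∑ x, φ x ^ 2 ∧ ∀ x y, |φ x - φ y| ≤ |p x - p y| by
    obtain ⟨φ, hφ0, hφ1, hφs, hφE, hφl⟩ := key
    have h3 := nash_nonneg hP hκ hε hpr hφ0 hφ1 hφs
    have h4 : ∑ x, ∑ y, P x y * (φ x - φ y) ^ 2 ≤ ∑ x, ∑ y, P x y * (p x - p y) ^ 2 :=
      Finset.sum_le_sum fun x _ => Finset.sum_le_sum fun y _ =>
        mul_le_mul_of_nonneg_left (sq_le_sq.2 (hφl x y)) (hP.nonneg x y)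
    refine le_trans ?_ (h3.trans h4)
    rcases hE0.eq_or_lt with h0 | hEpos
    · rw [← h0, Real.zero_rpow (by linarith), mul_zero]
      have : 0 ≤ ∑ x, φ x ^ 2 := Finset.sum_nonneg fun x _ => sq_nonneg _
      positivity
    set N := ∑ x, φ x ^ 2
    have h5 : E / 8 ≤ N / 4 := by linarith
    have h6 : (E / 8) ^ (1 - 2 * ε) ≤ (N / 4) ^ (1 - 2 * ε) :=
      Real.rpow_le_rpow (by positivity) h5 (by linarith)
    have h7 : E ^ (1 - 2 * ε) / 8 ≤ (E / 8) ^ (1 - 2 * ε) := by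
      rw [Real.div_rpow hEpos.le (by norm_num)]
      refine div_le_div_of_nonneg_left (by positivity) (by positivity) ?_
      calc (8 : ℝ) ^ (1 - 2 * ε) ≤ 8 ^ (1 : ℝ) :=
            Real.rpow_le_rpow_of_exponent_le (by norm_num) (by linarith)
        _ = 8 := Real.rpow_one _
    rw [Real.rpow_add hEpos, Real.rpow_one]
    have h8 : E / 2 * (E ^ (1 - 2 * ε) / 8) ≤ N * (N / 4) ^ (1 - 2 * ε) :=
      mul_le_mul hφE (h7.trans h6) (by positivity) (by linarith)
    have := mul_le_mul_of_nonneg_left h8 (show 0 ≤ κ ^ 2 / 2 by positivity)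
    linarith
  have hm0 : 0 ≤ m := hp y₀
  let φ : V → ℝ := fun x => max (p x - m) 0
  let ψ : V → ℝ := fun x => max (m - p x) 0
  have hsplit : ∑ x, (p x - m) ^ 2 = ∑ x, φ x ^ 2 + ∑ x, ψ x ^ 2 := by
    rw [← Finset.sum_add_distrib]
    refine Finset.sum_congr rfl fun x _ => ?_
    rcases le_total (p x) m with h | h
    · simp only [φ, ψ, max_eq_right (show p x - m ≤ 0 by linarith),
        max_eq_left (show 0 ≤ m - p x by linarith)]
      ring
    · simp only [φ, ψ, max_eq_left (show 0 ≤ p x - m by linarith),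
        max_eq_right (show m - p x ≤ 0 by linarith)]
      ring
  by_cases hc : ∑ x, ψ x ^ 2 ≤ ∑ x, φ x ^ 2
  · refine ⟨φ, fun x => le_max_right _ _, ?_, ?_, by linarith, fun x y => ?_⟩
    · rw [← h1]
      exact Finset.sum_le_sum fun x _ => max_le (by linarith) (hp x)
    · convert hhi using 4 with x
      simp [φ]
    · simpa [φ] using abs_max_sub_max_le_abs (p x - m) (p y - m) 0
  · refine ⟨ψ, fun x => le_max_right _ _, ?_, ?_, by linarith, fun x y => ?_⟩
    · -- at least half of the vertices carry mass `≥ m`, so the lower part has mass at most `1`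
      have h2 := Finset.card_filter_add_card_filter_not (s := (Finset.univ : Finset V))
        (fun x => p x < m)
      rw [Finset.card_univ] at h2
      have h3 : (Finset.univ.filter fun x => p x < m).card ≤
          (Finset.univ.filter fun x => ¬ p x < m).card := by omega
      calc ∑ x, ψ x ≤ ∑ x, (if p x < m then m else 0) := by
            refine Finset.sum_le_sum fun x _ => ?_
            split_ifs with h
            · exact max_le (by linarith [hp x]) hm0
            · exact max_le (by linarith) le_rfl
        _ = ((Finset.univ.filter fun x => p x < m).card : ℝ) * m := by
            rw [← Finset.sum_filter]; simp
        _ ≤ ((Finset.univ.filter fun x => ¬ p x < m).card : ℝ) * m := by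
            gcongr
        _ = ∑ x, (if ¬ p x < m then m else 0) := by
            rw [← Finset.sum_filter]; simp
        _ ≤ ∑ x, p x := by
            refine Finset.sum_le_sum fun x _ => ?_
            split_ifs with h
            · exact hp x
            · linarith
        _ = 1 := h1
    · convert hlo using 4 with x
      simp [ψ]
    · have := abs_max_sub_max_le_abs (m - p x) (m - p y) 0
      rw [show m - p x - (m - p y) = -(p x - p y) by ring, abs_neg] at this
      exact this

/-- Solutions of `a_{t+1} ≤ a_t - κ a_t^{1+δ}` decay like `(δ κ t)^{-1/δ}`. -/
lemma decay_of_step {a : ℕ → ℝ} {κ δ : ℝ} (ha : ∀ t, 0 ≤ a t) (hκ : 0 < κ) (hδ0 : 0 < δ)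
    (hδ1 : δ ≤ 1) (h : ∀ t, a (t + 1) ≤ a t - κ * a t ^ (1 + δ)) (t : ℕ) :
    δ * κ * t * a t ^ δ ≤ 1 := by
  induction t with
  | zero => simp
  | succ t ih =>
    rcases (ha (t + 1)).eq_or_lt with h0 | hpos
    · rw [← h0, Real.zero_rpow hδ0.ne']; simp
    have hat : 0 < a t := by
      rcases (ha t).eq_or_lt with h1 | h1
      · have := h t
        rw [← h1, Real.zero_rpow (by linarith)] at this
        linarith
      · exact h1
    have hs := h t
    rw [Real.rpow_add hat, Real.rpow_one] at hs
    set A := a t ^ δ with hA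
    have hA0 : 0 < A := Real.rpow_pos_of_pos hat _
    have hs' : a (t + 1) ≤ a t * (1 + -(κ * A)) := by linarith
    have hx : 0 < 1 + -(κ * A) := by
      by_contra hcon
      push Not at hcon
      nlinarith
    have hb : a (t + 1) ^ δ ≤ A * (1 - δ * κ * A) := by
      calc a (t + 1) ^ δ ≤ (a t * (1 + -(κ * A))) ^ δ :=
            Real.rpow_le_rpow (ha _) hs' hδ0.le
        _ = A * (1 + -(κ * A)) ^ δ := Real.mul_rpow hat.le hx.le
        _ ≤ A * (1 + δ * -(κ * A)) := by
            refine mul_le_mul_of_nonneg_left ?_ hA0.le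
            exact rpow_one_add_le_one_add_mul_self (by linarith) hδ0.le hδ1
        _ = A * (1 - δ * κ * A) := by ring
    have h0 : 0 ≤ δ * κ * ((t + 1 : ℕ) : ℝ) := by positivity
    have h2 := mul_le_mul_of_nonneg_left hb h0
    refine h2.trans ?_
    push_cast
    have hz : 0 ≤ 1 - δ * κ * A := by
      have := Real.rpow_nonneg (ha (t + 1)) δ
      by_contra hcon
      push Not at hcon
      nlinarith
    have hz0 : 0 < δ * κ * A := by positivity
    nlinarith [mul_le_mul_of_nonneg_right ih hz]

end Analysis

section Walk

variable {V : Type*} [Fintype V]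

/-! ### The lazy walk on a regular graph -/

lemma lazyMatrix_offDiag {H : SimpleGraph V} {d : ℕ} [DecidableRel H.Adj]
    (hr : H.IsRegularOfDegree d) {x y : V} (hxy : x ≠ y) :
    lazyMatrix H x y = if H.Adj x y then 1 / (2 * (d : ℝ)) else 0 := by
  classical
  have : H.degree x = d := hr x
  simp only [lazyMatrix, Matrix.of_apply, hxy, if_false]
  rw [← this]
  congr!

lemma lazyMatrix_diag (H : SimpleGraph V) (x : V) : lazyMatrix H x x = 1 / 2 := by
  simp [lazyMatrix]

lemma isLazySymm_lazyMatrix [DecidableEq V] {H : SimpleGraph V} {d : ℕ} [DecidableRel H.Adj]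
    (hr : H.IsRegularOfDegree d) (hd : 0 < d) : IsLazySymm (lazyMatrix H) where
  symm x y := by
    by_cases hxy : x = y
    · rw [hxy]
    · rw [lazyMatrix_offDiag hr hxy, lazyMatrix_offDiag hr (Ne.symm hxy)]
      simp only [H.adj_comm]
  nonneg x y := by
    by_cases hxy : x = y
    · rw [hxy, lazyMatrix_diag]; norm_num
    · rw [lazyMatrix_offDiag hr hxy]; positivity
  sum_row x := by
    have h : ∀ y, lazyMatrix H x y =
        (if x = y then 1 / 2 else 0) + if H.Adj x y then 1 / (2 * (d : ℝ)) else 0 := by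
      intro y
      by_cases hxy : x = y
      · subst hxy; rw [lazyMatrix_diag]; simp
      · rw [lazyMatrix_offDiag hr hxy]; simp [hxy]
    simp_rw [h, Finset.sum_add_distrib]
    rw [Finset.sum_ite_eq, ← Finset.sum_filter, Finset.sum_const, ← H.neighborFinset_eq_filter,
      H.card_neighborFinset_eq_degree, hr x]
    have : (0 : ℝ) < d := by exact_mod_cast hd
    simp only [Finset.mem_univ, if_true, nsmul_eq_mul]
    field_simp
    norm_num
  half_le_diag x := by rw [lazyMatrix_diag]

lemma sum_cut_lazyMatrix [DecidableEq V] {H : SimpleGraph V} {d : ℕ} [DecidableRel H.Adj]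
    (hr : H.IsRegularOfDegree d) (A : Finset V) :
    ∑ x ∈ A, ∑ y ∈ Aᶜ, lazyMatrix H x y = ((H.interedges A Aᶜ).card : ℝ) / (2 * d) := by
  have h : ∑ x ∈ A, ∑ y ∈ Aᶜ, lazyMatrix H x y =
      ∑ x ∈ A, ∑ y ∈ Aᶜ, if H.Adj x y then 1 / (2 * (d : ℝ)) else 0 := by
    refine Finset.sum_congr rfl fun x hx => Finset.sum_congr rfl fun y hy => ?_
    refine lazyMatrix_offDiag hr ?_
    rintro rfl
    exact Finset.mem_compl.1 hy hx
  rw [h, ← Finset.sum_product', ← Finset.sum_filter, Finset.sum_const, nsmul_eq_mul,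
    mul_one_div]
  rfl

/-- The standing hypothesis on the sequence of walks, invariant under shifts and time reversal:
each step is a lazy symmetric stochastic matrix with isoperimetric profile `κ |A|^(1/2 + ε)`. -/
def IsGood [DecidableEq V] (κ ε : ℝ) (G : ℕ → SimpleGraph V) : Prop :=
  ∀ t, IsLazySymm (lazyMatrix (G t)) ∧ HasProfile κ (1 / 2 + ε) (lazyMatrix (G t))

lemma IsGood.comp [DecidableEq V] {κ ε : ℝ} {G : ℕ → SimpleGraph V} (h : IsGood κ ε G)
    (r : ℕ → ℕ) : IsGood κ ε (fun i => G (r i)) := fun t => h (r t)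

lemma isGood_of_isoperimetric [DecidableEq V] {Δ : ℕ} {c ε : ℝ} (hc : 0 < c)
    {G : ℕ → SimpleGraph V} (hV : 2 ≤ Fintype.card V) (hr : IsRegularBounded Δ G)
    (hi : IsIsoperimetric c ε G) : IsGood (c / (2 * (Δ + 1))) ε G := by
  classical
  intro t
  obtain ⟨d, hdΔ, hd⟩ := hr t
  have hcut : ∀ A : Finset V, 1 ≤ A.card → 2 * A.card ≤ Fintype.card V →
      c * (A.card : ℝ) ^ (1 / 2 + ε) ≤ (((G t).interedges A Aᶜ).card : ℝ) := by
    intro A h1 h2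
    convert hi t A h1 h2
  -- a single vertex has a neighbour
  have hd0 : 0 < d := by
    rcases Nat.eq_zero_or_pos d with h0 | h0
    · exfalso
      have : Nonempty V := Fintype.card_pos_iff.1 (by omega)
      obtain ⟨x⟩ := this
      have h1 := hcut {x} (by simp) (by simpa using hV)
      have h2 : (G t).interedges {x} {x}ᶜ = ∅ := by
        rw [Finset.eq_empty_iff_forall_notMem]
        rintro ⟨a, b⟩ hab
        rw [SimpleGraph.mem_interedges_iff] at hab
        have h3 := (SimpleGraph.degree_pos_iff_exists_adj (G := G t) a).2 ⟨b, hab.2.2⟩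
        have h4 : (G t).degree a = d := hd a
        omega
      rw [h2] at h1
      simp at h1
      linarith
    · exact h0
  refine ⟨isLazySymm_lazyMatrix hd hd0, fun A h1 h2 => ?_⟩
  rw [sum_cut_lazyMatrix hd]
  have hd0' : (0 : ℝ) < d := by exact_mod_cast hd0
  have hdΔ' : (d : ℝ) ≤ Δ + 1 := by exact_mod_cast hdΔ.trans (Nat.le_succ _)
  rw [div_mul_eq_mul_div]
  exact div_le_div₀ (by positivity) (hcut A h1 h2) (by positivity) (by linarith)

/-! ### Transition probabilities -/

lemma transProb_add (G : ℕ → SimpleGraph V) (a b : ℕ) :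
    transProb G (a + b) = transProb G a * transProb (fun i => G (a + i)) b := by
  induction b with
  | zero => simp [transProb]
  | succ b ih => rw [← add_assoc, transProb, ih, transProb, Matrix.mul_assoc]

lemma transProb_succ' (G : ℕ → SimpleGraph V) (t : ℕ) :
    transProb G (t + 1) = lazyMatrix (G 0) * transProb (fun i => G (i + 1)) t := by
  rw [add_comm t 1, transProb_add]
  simp [transProb, add_comm]

/-- The squared `ℓ²` distance, for the counting measure, of the time-`t` distribution from the
uniform distribution. -/
noncomputable def energy (G : ℕ → SimpleGraph V) (u : V) (t : ℕ) : ℝ :=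
  ∑ x, (transProb G t u x - 1 / Fintype.card V) ^ 2

lemma energy_nonneg (G : ℕ → SimpleGraph V) (u : V) (t : ℕ) : 0 ≤ energy G u t :=
  Finset.sum_nonneg fun _ _ => sq_nonneg _

lemma l2Dist_unif [Nonempty V] (p : V → ℝ) :
    l2Dist (unif V) p = Real.sqrt (Fintype.card V * ∑ x, (p x - 1 / Fintype.card V) ^ 2) := by
  have hn : (0 : ℝ) < Fintype.card V := by exact_mod_cast Fintype.card_pos
  rw [l2Dist, Finset.mul_sum]
  congr 1
  refine Finset.sum_congr rfl fun x _ => ?_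
  simp only [unif]
  field_simp

variable [DecidableEq V] {κ ε : ℝ} {G : ℕ → SimpleGraph V}

/-- Since the steps are symmetric, the transpose of the transition matrix belongs to the
time-reversed sequence. -/
lemma transProb_apply_swap (t : ℕ) : ∀ {G : ℕ → SimpleGraph V}, IsGood κ ε G → ∀ x y,
    transProb G t x y = transProb (fun i => G (t - 1 - i)) t y x := by
  induction t with
  | zero =>
    intro G _ x y
    simp [transProb, Matrix.one_apply, eq_comm]
  | succ t ih =>
    intro G hG x y
    rw [transProb_succ' (fun i => G (t + 1 - 1 - i)), transProb, Matrix.mul_apply, Matrix.mul_apply]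
    refine Finset.sum_congr rfl fun z _ => ?_
    rw [ih hG x z, mul_comm, (hG t).1.symm z y]
    simp only [Nat.add_sub_cancel, Nat.sub_zero]
    congr 3
    funext i
    congr 1
    omega

lemma transProb_nonneg (hG : IsGood κ ε G) (t : ℕ) (x y : V) : 0 ≤ transProb G t x y := by
  induction t generalizing y with
  | zero => simp only [transProb, Matrix.one_apply]; positivity
  | succ t ih =>
    rw [transProb, Matrix.mul_apply]
    exact Finset.sum_nonneg fun z _ => mul_nonneg (ih z) ((hG t).1.nonneg z y)

lemma sum_transProb (hG : IsGood κ ε G) (t : ℕ) (x : V) : ∑ y, transProb G t x y = 1 := by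
  induction t with
  | zero =>
    rw [Finset.sum_eq_single x] <;> simp +contextual [transProb, eq_comm]
  | succ t ih =>
    simp_rw [transProb, Matrix.mul_apply]
    rw [Finset.sum_comm]
    simp_rw [← Finset.mul_sum, (hG t).1.sum_row, mul_one, ih]

lemma energy_step [Nonempty V] (hG : IsGood κ ε G) (hκ : 0 ≤ κ) (hε0 : 0 ≤ ε) (hε : ε ≤ 1 / 4)
    (u : V) (t : ℕ) :
    energy G u (t + 1) ≤ energy G u t - κ ^ 2 / 64 * energy G u t ^ (1 + (1 - 2 * ε)) := by
  have hP := (hG t).1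
  have h1 := sum_sq_step_le hP (fun x => transProb G t u x - 1 / Fintype.card V)
  have h2 := nash_prob hP hκ hε0 hε (hG t).2 (transProb_nonneg hG t u) (sum_transProb hG t u)
  have h3 : ∀ y, ∑ x, (transProb G t u x - 1 / Fintype.card V) * lazyMatrix (G t) x y =
      transProb G (t + 1) u y - 1 / Fintype.card V := by
    intro y
    have : ∑ x, lazyMatrix (G t) x y = 1 := by
      rw [← hP.sum_row y]
      exact Finset.sum_congr rfl fun x _ => hP.symm x y
    simp_rw [sub_mul, Finset.sum_sub_distrib, ← Finset.mul_sum, this, transProb, Matrix.mul_apply,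
      mul_one]
  simp_rw [h3, sub_sub_sub_cancel_right] at h1
  rw [energy, energy]
  linarith

lemma energy_decay [Nonempty V] (hG : IsGood κ ε G) (hκ : 0 < κ) (hε0 : 0 ≤ ε) (hε : ε ≤ 1 / 4)
    (u : V) {t : ℕ} (ht : 0 < t) :
    energy G u t ^ (1 - 2 * ε) ≤ 128 / κ ^ 2 / t := by
  have h := decay_of_step (δ := 1 - 2 * ε) (κ := κ ^ 2 / 64) (energy_nonneg G u) (by positivity)
    (by linarith) (by linarith) (energy_step hG hκ.le hε0 hε u) t
  have ht' : (0 : ℝ) < t := by exact_mod_cast ht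
  have h0 := Real.rpow_nonneg (energy_nonneg G u t) (1 - 2 * ε)
  set A := energy G u t ^ (1 - 2 * ε)
  rw [div_div, le_div_iff₀ (by positivity)]
  have h1 : 1 / 2 * (κ ^ 2 / 64 * t * A) ≤ (1 - 2 * ε) * (κ ^ 2 / 64 * t * A) :=
    mul_le_mul_of_nonneg_right (by linarith) (by positivity)
  linarith

/-! ### Mixing time -/

lemma exists_mixed [Nonempty V] (hG : IsGood κ ε G) (hκ : 0 < κ) (hε0 : 0 ≤ ε) (hε : ε ≤ 1 / 4) :
    ∃ t ∈ mixedTimes (unif V) G,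
      (t : ℝ) ≤ (1152 / κ ^ 2 + 1) * (Fintype.card V : ℝ) ^ (1 - 2 * ε) := by
  have hn : (1 : ℝ) ≤ Fintype.card V := by exact_mod_cast Fintype.card_pos
  have hn0 : (0 : ℝ) < Fintype.card V := by linarith
  set n := (Fintype.card V : ℝ)
  have hnδ : 1 ≤ n ^ (1 - 2 * ε) := Real.one_le_rpow hn (by linarith)
  have hpos : 0 < 1152 / κ ^ 2 * n ^ (1 - 2 * ε) := by positivity
  refine ⟨⌈1152 / κ ^ 2 * n ^ (1 - 2 * ε)⌉₊, fun u => ?_, ?_⟩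
  · set t := ⌈1152 / κ ^ 2 * n ^ (1 - 2 * ε)⌉₊ with ht
    have ht0 : 0 < t := Nat.ceil_pos.2 hpos
    have htle : 1152 / κ ^ 2 * n ^ (1 - 2 * ε) ≤ t := Nat.le_ceil _
    have hE := energy_decay hG hκ hε0 hε u ht0
    have ht0' : (0 : ℝ) < t := by exact_mod_cast ht0
    have h1 : energy G u t ^ (1 - 2 * ε) ≤ (1 / (9 * n)) ^ (1 - 2 * ε) := by
      refine hE.trans ?_
      rw [Real.div_rpow zero_le_one (by positivity), Real.one_rpow,
        Real.mul_rpow (by norm_num) hn0.le, div_le_div_iff₀ ht0' (by positivity), one_mul]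
      refine le_trans ?_ htle
      have h9 : (9 : ℝ) ^ (1 - 2 * ε) ≤ 9 := by
        calc (9 : ℝ) ^ (1 - 2 * ε) ≤ 9 ^ (1 : ℝ) :=
            Real.rpow_le_rpow_of_exponent_le (by norm_num) (by linarith)
          _ = 9 := Real.rpow_one _
      calc 128 / κ ^ 2 * (9 ^ (1 - 2 * ε) * n ^ (1 - 2 * ε))
          ≤ 128 / κ ^ 2 * (9 * n ^ (1 - 2 * ε)) := by gcongr
        _ = 1152 / κ ^ 2 * n ^ (1 - 2 * ε) := by ring
    have h2 : energy G u t ≤ 1 / (9 * n) := by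
      by_contra hcon
      push Not at hcon
      exact absurd h1 (not_le.2 (Real.rpow_lt_rpow (by positivity) hcon (by linarith)))
    rw [l2Dist_unif, Real.sqrt_le_left (by norm_num)]
    change n * energy G u t ≤ _
    calc n * energy G u t ≤ n * (1 / (9 * n)) := by gcongr
      _ = (1 / 3) ^ 2 := by field_simp; norm_num
  · have := (Nat.ceil_lt_add_one hpos.le).le
    linarith

/-! ### Pointwise convergence -/

/-- Splitting the time interval in the middle and applying Cauchy–Schwarz bounds the pointwise
deviation by the energies of the first half and of the time-reversed second half. -/
lemma abs_transProb_sub_le_energy [Nonempty V] (hG : IsGood κ ε G) (a b : ℕ) (u v : V) :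
    |transProb G (a + b) u v - 1 / Fintype.card V| ≤
      (energy G u a + energy (fun i => G (a + (b - 1 - i))) v b) / 2 := by
  have hn : (0 : ℝ) < Fintype.card V := by exact_mod_cast Fintype.card_pos
  have hG' : IsGood κ ε (fun i => G (a + i)) := hG.comp _
  have hG'' : IsGood κ ε (fun i => G (a + (b - 1 - i))) := hG.comp fun i => a + (b - 1 - i)
  have h1 : transProb G (a + b) u v - 1 / Fintype.card V =
      ∑ z, (transProb G a u z - 1 / Fintype.card V) *
        (transProb (fun i => G (a + (b - 1 - i))) b v z - 1 / Fintype.card V) := by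
    rw [transProb_add, Matrix.mul_apply]
    simp_rw [transProb_apply_swap b hG' _ v, sub_mul, mul_sub, Finset.sum_sub_distrib,
      ← Finset.mul_sum, ← Finset.sum_mul, sum_transProb hG, sum_transProb hG'']
    simp
  rw [h1, energy, energy, ← Finset.sum_add_distrib, Finset.sum_div]
  refine (Finset.abs_sum_le_sum_abs _ _).trans (Finset.sum_le_sum fun z _ => ?_)
  set p := transProb G a u z - 1 / Fintype.card V
  set q := transProb (fun i => G (a + (b - 1 - i))) b v z - 1 / Fintype.card V
  rw [abs_le]
  constructor <;> nlinarith [sq_nonneg (p + q), sq_nonneg (p - q)]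

lemma transProb_le_one (hG : IsGood κ ε G) (t : ℕ) (x y : V) : transProb G t x y ≤ 1 := by
  rw [← sum_transProb hG t x]
  exact Finset.single_le_sum (fun z _ => transProb_nonneg hG t x z) (Finset.mem_univ y)

lemma abs_transProb_sub_le [Nonempty V] (hG : IsGood κ ε G) (hκ : 0 < κ) (hε0 : 0 ≤ ε)
    (hε : ε ≤ 1 / 4) {t : ℕ} (ht : 1 ≤ t) (u v : V) :
    |transProb G t u v - 1 / Fintype.card V| ≤
      (384 / κ ^ 2 + 1) ^ 2 / (t : ℝ) ^ (1 + 2 * ε) := by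
  have hn : (1 : ℝ) ≤ Fintype.card V := by exact_mod_cast Fintype.card_pos
  have htr : (1 : ℝ) ≤ t := by exact_mod_cast ht
  have ht0 : (0 : ℝ) < t := by linarith
  set K := 384 / κ ^ 2 + 1 with hK
  have hK1 : 1 ≤ K := by rw [hK]; have : 0 ≤ 384 / κ ^ 2 := by positivity
                         linarith
  set X := |transProb G t u v - 1 / Fintype.card V| with hX
  have hX0 : 0 ≤ X := abs_nonneg _
  have hδ : 0 < 1 - 2 * ε := by linarith
  have key : X ^ (1 - 2 * ε) ≤ K / t := by
    rcases ht.eq_or_lt with h1 | h1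
    · have hX1 : X ≤ 1 := by
        rw [hX, abs_le]
        have h2 := transProb_nonneg hG t u v
        have h3 := transProb_le_one hG t u v
        have h4 : 1 / (Fintype.card V : ℝ) ≤ 1 := by
          rw [div_le_one (by linarith)]; exact hn
        have h5 : 0 ≤ 1 / (Fintype.card V : ℝ) := by positivity
        constructor <;> linarith
      rw [← h1]
      simpa using (Real.rpow_le_one hX0 hX1 hδ.le).trans hK1
    · have hab : t / 2 + (t - t / 2) = t := by omega
      have hXE := abs_transProb_sub_le_energy hG (t / 2) (t - t / 2) u v
      rw [hab] at hXE
      have hhalf : ∀ s : ℕ, t ≤ 3 * s → ∀ (G' : ℕ → SimpleGraph V) (w : V), IsGood κ ε G' →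
          energy G' w s ^ (1 - 2 * ε) ≤ K / t := by
        intro s hs G' w hG'
        refine (energy_decay hG' hκ hε0 hε w (by omega)).trans ?_
        have hs' : (t : ℝ) ≤ 3 * s := by exact_mod_cast hs
        have hs0 : (0 : ℝ) < s := by linarith
        rw [div_le_div_iff₀ hs0 ht0]
        have h6 : 128 / κ ^ 2 * t ≤ 128 / κ ^ 2 * (3 * s) := by gcongr
        have h7 : 128 / κ ^ 2 * (3 * s) = 384 / κ ^ 2 * s := by ring
        have h8 : K * s = 384 / κ ^ 2 * s + s := by rw [hK]; ring
        linarith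
      rcases le_total (energy G u (t / 2))
        (energy (fun i => G (t / 2 + (t - t / 2 - 1 - i))) v (t - t / 2)) with hle | hle
      · refine (Real.rpow_le_rpow hX0 (hXE.trans (by linarith)) hδ.le).trans
          (hhalf (t - t / 2) (by omega) _ v (hG.comp fun i => t / 2 + (t - t / 2 - 1 - i)))
      · refine (Real.rpow_le_rpow hX0 (hXE.trans (by linarith)) hδ.le).trans
          (hhalf (t / 2) (by omega) _ u hG)
  have h1 : X = (X ^ (1 - 2 * ε)) ^ (1 / (1 - 2 * ε)) := by
    rw [← Real.rpow_mul hX0, mul_one_div_cancel hδ.ne', Real.rpow_one]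
  have hinv : 1 + 2 * ε ≤ 1 / (1 - 2 * ε) := by
    rw [le_div_iff₀ hδ]; nlinarith
  have hinv2 : 1 / (1 - 2 * ε) ≤ 2 := by
    rw [div_le_iff₀ hδ]; linarith
  have hinv0 : 0 ≤ 1 / (1 - 2 * ε) := by linarith
  calc X ≤ (K / t) ^ (1 / (1 - 2 * ε)) := by
        rw [h1]
        exact Real.rpow_le_rpow (Real.rpow_nonneg hX0 _) key hinv0
    _ = K ^ (1 / (1 - 2 * ε)) / (t : ℝ) ^ (1 / (1 - 2 * ε)) :=
        Real.div_rpow (by linarith) ht0.le _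
    _ ≤ K ^ 2 / (t : ℝ) ^ (1 + 2 * ε) := by
        refine div_le_div₀ (by positivity) ?_ (by positivity)
          (Real.rpow_le_rpow_of_exponent_le htr hinv)
        rw [← Real.rpow_natCast]
        exact Real.rpow_le_rpow_of_exponent_le hK1 (by exact_mod_cast hinv2)

end Walk

section Hitting

variable {V : Type*} [Fintype V]

/-! ### Expected visits and avoidance probabilities -/

/-- The expected number of visits to `v` at the times `s + 1, …, s + L` of the walk which is at `y`
at time `s`. -/
noncomputable def expVisits (G : ℕ → SimpleGraph V) (v : V) (L s : ℕ) (y : V) : ℝ :=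
  ∑ t ∈ Finset.range L, transProb (fun i => G (s + i)) (t + 1) y v

lemma expVisits_succ (G : ℕ → SimpleGraph V) (v : V) (L s : ℕ) (y : V) :
    expVisits G v (L + 1) s y =
      lazyMatrix (G s) y v + ∑ z, lazyMatrix (G s) y z * expVisits G v L (s + 1) z := by
  rw [expVisits, Finset.sum_range_succ', add_comm]
  congr 1
  · simp [transProb]
  · simp_rw [expVisits, Finset.mul_sum]
    rw [Finset.sum_comm]
    refine Finset.sum_congr rfl fun t _ => ?_
    rw [transProb_succ', Matrix.mul_apply]
    refine Finset.sum_congr rfl fun z _ => ?_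
    simp only [add_zero, add_assoc, add_comm 1]

variable [DecidableEq V] {κ ε : ℝ} {G : ℕ → SimpleGraph V}

/-- `avoidProb G v k s y` is the probability that the walk which is at `y` at time `s` is not at
`v` at any of the times `s + 1, …, s + k`. -/
noncomputable def avoidProb (G : ℕ → SimpleGraph V) (v : V) : ℕ → ℕ → V → ℝ
  | 0, _, _ => 1
  | k + 1, s, y => ∑ z ∈ Finset.univ.erase v, lazyMatrix (G s) y z * avoidProb G v k (s + 1) z

lemma avoidProb_nonneg (hG : IsGood κ ε G) (v : V) (k s : ℕ) (y : V) : 0 ≤ avoidProb G v k s y := by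
  induction k generalizing s y with
  | zero => exact zero_le_one
  | succ k ih => exact Finset.sum_nonneg fun z _ => mul_nonneg ((hG s).1.nonneg y z) (ih _ _)

lemma avoidProb_le_one (hG : IsGood κ ε G) (v : V) (k s : ℕ) (y : V) : avoidProb G v k s y ≤ 1 := by
  induction k generalizing s y with
  | zero => exact le_rfl
  | succ k ih =>
    rw [avoidProb, ← (hG s).1.sum_row y]
    refine (Finset.sum_le_sum fun z _ => mul_le_of_le_one_right ((hG s).1.nonneg y z) (ih _ _)).trans
      (Finset.sum_le_sum_of_subset_of_nonneg (Finset.erase_subset _ _) fun z _ _ =>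
        (hG s).1.nonneg y z)

lemma avoidProb_add_le (hG : IsGood κ ε G) {v : V} {b : ℕ} {ρ : ℝ}
    (hρ : ∀ s z, avoidProb G v b s z ≤ ρ) (a s : ℕ) (y : V) :
    avoidProb G v (a + b) s y ≤ avoidProb G v a s y * ρ := by
  induction a generalizing s y with
  | zero => simpa [avoidProb] using hρ s y
  | succ a ih =>
    rw [Nat.succ_add, avoidProb, avoidProb, Finset.sum_mul]
    refine Finset.sum_le_sum fun z _ => ?_
    rw [mul_assoc]
    exact mul_le_mul_of_nonneg_left (ih _ _) ((hG s).1.nonneg y z)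

/-- If every time window of length `L` contains a visit to `v` with probability at least `q`, then
the partial sums `S_K` of the survival probabilities satisfy `S_K ≤ L + (1 - q) S_K`. -/
lemma sum_avoidProb_le (hG : IsGood κ ε G) {v : V} {L : ℕ} {q : ℝ} (hq : 0 < q)
    (h : ∀ s z, avoidProb G v L s z ≤ 1 - q) (K s : ℕ) (y : V) :
    ∑ k ∈ Finset.range K, avoidProb G v k s y ≤ L / q := by
  have h1 : ∑ k ∈ Finset.range K, avoidProb G v k s y ≤
      ∑ k ∈ Finset.range (L + K), avoidProb G v k s y :=
    Finset.sum_le_sum_of_subset_of_nonneg (Finset.range_subset_range.2 (by omega))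
      fun k _ _ => avoidProb_nonneg hG v k s y
  rw [Finset.sum_range_add] at h1
  have h2 : ∑ k ∈ Finset.range L, avoidProb G v k s y ≤ L := by
    refine (Finset.sum_le_sum fun k _ => avoidProb_le_one hG v k s y).trans ?_
    simp
  have h3 : ∑ k ∈ Finset.range K, avoidProb G v (L + k) s y ≤
      (∑ k ∈ Finset.range K, avoidProb G v k s y) * (1 - q) := by
    rw [Finset.sum_mul]
    refine Finset.sum_le_sum fun k _ => ?_
    rw [add_comm L k]
    exact avoidProb_add_le hG h k s y
  rw [le_div_iff₀ hq]
  linarith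

lemma expVisits_mono (hG : IsGood κ ε G) (v : V) {k L : ℕ} (hkL : k ≤ L) (s : ℕ) (y : V) :
    expVisits G v k s y ≤ expVisits G v L s y :=
  Finset.sum_le_sum_of_subset_of_nonneg (Finset.range_subset_range.2 hkL)
    fun _ _ _ => transProb_nonneg (hG.comp fun i => s + i) _ _ _

/-- First-passage decomposition: once the walk has reached `v`, it visits `v` at most `S` times in
expectation, so the expected number of visits is at most `S` times the probability of a visit. -/
lemma expVisits_le (hG : IsGood κ ε G) {v : V} {L : ℕ} {S : ℝ}
    (hS : ∀ s, 1 + expVisits G v L s v ≤ S) {k : ℕ} (hk : k ≤ L) (s : ℕ) (y : V) :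
    expVisits G v k s y ≤ S * (1 - avoidProb G v k s y) := by
  induction k generalizing s y with
  | zero => simp [expVisits, avoidProb]
  | succ k ih =>
    have hP := (hG s).1
    rw [expVisits_succ, ← Finset.add_sum_erase _ _ (Finset.mem_univ v), avoidProb]
    have h1 : lazyMatrix (G s) y v * (1 + expVisits G v k (s + 1) v) ≤ lazyMatrix (G s) y v * S :=
      mul_le_mul_of_nonneg_left
        (le_trans (by gcongr; exact expVisits_mono hG v (by omega) _ _) (hS (s + 1)))
        (hP.nonneg y v)
    have h2 : ∑ z ∈ Finset.univ.erase v, lazyMatrix (G s) y z * expVisits G v k (s + 1) z ≤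
        ∑ z ∈ Finset.univ.erase v,
          lazyMatrix (G s) y z * (S * (1 - avoidProb G v k (s + 1) z)) :=
      Finset.sum_le_sum fun z _ =>
        mul_le_mul_of_nonneg_left (ih (by omega) _ _) (hP.nonneg y z)
    have h3 : ∑ z ∈ Finset.univ.erase v,
          lazyMatrix (G s) y z * (S * (1 - avoidProb G v k (s + 1) z)) =
        S * (∑ z ∈ Finset.univ.erase v, lazyMatrix (G s) y z -
          ∑ z ∈ Finset.univ.erase v, lazyMatrix (G s) y z * avoidProb G v k (s + 1) z) := by
      rw [← Finset.sum_sub_distrib, Finset.mul_sum]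
      exact Finset.sum_congr rfl fun z _ => by ring
    have h4 : lazyMatrix (G s) y v + ∑ z ∈ Finset.univ.erase v, lazyMatrix (G s) y z = 1 := by
      rw [Finset.add_sum_erase _ _ (Finset.mem_univ v), hP.sum_row]
    rw [← h4]
    linarith

/-! ### Hitting times of the process -/

/-- Upper bound for the probability of following a given path up to time `s` and avoiding `v` for
`k` more steps. -/
lemma measure_path_avoid_le (hG : IsGood κ ε G) {Ω : Type*} [MeasurableSpace Ω] {μ : Measure Ω}
    {X : ℕ → Ω → V} {u : V} (hX : IsLazyWalk G u μ X) (v : V) (k s : ℕ) (x : ℕ → V)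
    (hx : x 0 = u) :
    μ {ω | (∀ i ≤ s, X i ω = x i) ∧ ∀ i, s < i → i ≤ s + k → X i ω ≠ v} ≤
      ENNReal.ofReal ((∏ i ∈ Finset.range s, lazyMatrix (G i) (x i) (x (i + 1))) *
        avoidProb G v k s (x s)) := by
  induction k generalizing s x with
  | zero =>
    rw [avoidProb, mul_one, ← hX.path_law s x hx]
    exact measure_mono fun ω hω => hω.1
  | succ k ih =>
    let x' : V → ℕ → V := fun z => Function.update x (s + 1) z
    have hx' : ∀ z i, i ≤ s → x' z i = x i := fun z i hi =>
      Function.update_of_ne (by omega) _ _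
    have hx'' : ∀ z, x' z (s + 1) = z := fun z => Function.update_self _ _ _
    have hsub : {ω | (∀ i ≤ s, X i ω = x i) ∧ ∀ i, s < i → i ≤ s + (k + 1) → X i ω ≠ v} ⊆
        ⋃ z ∈ Finset.univ.erase v, {ω | (∀ i ≤ s + 1, X i ω = x' z i) ∧
          ∀ i, s + 1 < i → i ≤ s + 1 + k → X i ω ≠ v} := by
      rintro ω ⟨h1, h2⟩
      simp only [Set.mem_iUnion]
      refine ⟨X (s + 1) ω, Finset.mem_erase.2 ⟨h2 _ (by omega) (by omega), Finset.mem_univ _⟩,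
        fun i hi => ?_, fun i hi hi' => h2 i (by omega) (by omega)⟩
      rcases Nat.le_succ_iff.1 hi with hi | hi
      · rw [hx' _ i hi, h1 i hi]
      · rw [hi]; exact (hx'' _).symm
    refine (measure_mono hsub).trans ((measure_biUnion_finset_le _ _).trans ?_)
    rw [avoidProb, Finset.mul_sum, ENNReal.ofReal_sum_of_nonneg]
    · refine Finset.sum_le_sum fun z _ => (ih (s + 1) (x' z) ?_).trans (le_of_eq ?_)
      · rw [hx' z 0 (Nat.zero_le _), hx]
      · rw [Finset.prod_range_succ, hx'', hx' z s le_rfl, mul_assoc]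
        congr 2
        refine Finset.prod_congr rfl fun i hi => ?_
        have := Finset.mem_range.1 hi
        rw [hx' z i (by omega), hx' z (i + 1) (by omega)]
    · intro z _
      exact mul_nonneg (Finset.prod_nonneg fun i _ => (hG i).1.nonneg _ _)
        (mul_nonneg ((hG s).1.nonneg _ _) (avoidProb_nonneg hG _ _ _ _))

lemma measure_avoid_le (hG : IsGood κ ε G) {Ω : Type*} [MeasurableSpace Ω] {μ : Measure Ω}
    {X : ℕ → Ω → V} {u : V} (hX : IsLazyWalk G u μ X) (v : V) (k : ℕ) :
    μ {ω | ∀ i ≤ k, X i ω ≠ v} ≤ ENNReal.ofReal (avoidProb G v k 0 u) := by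
  have h := measure_path_avoid_le hG hX v k 0 (fun _ => u) rfl
  rw [Finset.prod_range_zero, one_mul] at h
  refine le_trans (measure_mono_ae ?_) h
  filter_upwards [hX.start] with ω hω
  intro (hav : ∀ i ≤ k, X i ω ≠ v)
  refine ⟨fun i hi => ?_, fun i _ hi => hav i (by omega)⟩
  rw [Nat.le_zero.1 hi, hω]

end Hitting

section HittingTime

/-- The layer-cake formula for the hitting time, as an inequality. -/
lemma hitTime_le_tsum {V Ω : Type*} (X : ℕ → Ω → V) (v : V) (ω : Ω) :
    hitTime X v ω ≤ ∑' k : ℕ, Set.indicator {ω | ∀ i ≤ k, X i ω ≠ v} (fun _ => (1 : ℝ≥0∞)) ω := by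
  classical
  by_cases h : ∃ t, X t ω = v
  · refine (iInf₂_le (Nat.find h) (Nat.find_spec h)).trans ?_
    have h1 : ((Nat.find h : ℕ) : ℝ≥0∞) = ∑ k ∈ Finset.range (Nat.find h),
        Set.indicator {ω | ∀ i ≤ k, X i ω ≠ v} (fun _ => (1 : ℝ≥0∞)) ω := by
      rw [Finset.sum_congr rfl (g := fun _ => (1 : ℝ≥0∞))]
      · simp
      · intro k hk
        refine Set.indicator_of_mem ?_ _
        intro i hi
        exact Nat.find_min h (lt_of_le_of_lt hi (Finset.mem_range.1 hk))
    rw [h1]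
    exact ENNReal.sum_le_tsum _
  · push Not at h
    have h1 : ∀ k : ℕ, Set.indicator {ω | ∀ i ≤ k, X i ω ≠ v} (fun _ => (1 : ℝ≥0∞)) ω = 1 :=
      fun k => Set.indicator_of_mem (s := {ω | ∀ i ≤ k, X i ω ≠ v}) (fun i _ => h i) _
    simp_rw [h1]
    rw [ENNReal.tsum_const_eq_top_of_ne_zero one_ne_zero]
    exact le_top

variable {V : Type*} [Fintype V] [DecidableEq V] {κ ε : ℝ} {G : ℕ → SimpleGraph V}

lemma lintegral_hitTime_le (hG : IsGood κ ε G) {Ω : Type*} [MeasurableSpace Ω] {μ : Measure Ω}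
    {X : ℕ → Ω → V} {u : V} (hX : IsLazyWalk G u μ X) (v : V) {B : ℝ}
    (hB : ∀ K, ∑ k ∈ Finset.range K, avoidProb G v k 0 u ≤ B) :
    ∫⁻ ω, hitTime X v ω ∂μ ≤ ENNReal.ofReal B := by
  have hm : ∀ k : ℕ, MeasurableSet {ω | ∀ i ≤ k, X i ω ≠ v} := by
    intro k
    have : {ω | ∀ i ≤ k, X i ω ≠ v} = ⋂ i, ⋂ (_ : i ≤ k), {ω | X i ω = v}ᶜ := by
      ext ω; simp
    rw [this]
    exact MeasurableSet.iInter fun i => MeasurableSet.iInter fun _ =>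
      (hX.measurableSet_eq i v).compl
  refine (lintegral_mono (hitTime_le_tsum X v)).trans ?_
  rw [lintegral_tsum fun k => (measurable_const.indicator (hm k)).aemeasurable]
  simp_rw [lintegral_indicator (hm _), setLIntegral_const, one_mul]
  refine (ENNReal.tsum_le_tsum fun k => measure_avoid_le hG hX v k).trans ?_
  refine ENNReal.tsum_le_of_sum_range_le fun K => ?_
  rw [← ENNReal.ofReal_sum_of_nonneg fun k _ => avoidProb_nonneg hG v k 0 u]
  exact ENNReal.ofReal_le_ofReal (hB K)

/-- A window of length `L ≈ (2 C + 2) n` contains at least `1/2` expected visits to `v`, all from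
its last `n` times, while the walk started at `v` returns at most
`2 C + 2 + C ∑ t ^ (-(1 + 2 ε))` times in expectation. -/
lemma lintegral_hitTime_le_of_pointwise [Nonempty V] (hG : IsGood κ ε G) (hε0 : 0 ≤ ε)
    {C Z : ℝ} (hC : 1 ≤ C) (hZ0 : 0 ≤ Z)
    (hpt : ∀ s t : ℕ, 1 ≤ t → ∀ x y,
      |transProb (fun i => G (s + i)) t x y - 1 / Fintype.card V| ≤ C / (t : ℝ) ^ (1 + 2 * ε))
    (hZ : ∀ L : ℕ, (L : ℝ) ≤ (2 * C + 2) * Fintype.card V →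
      ∑ t ∈ Finset.range L, 1 / ((t + 1 : ℕ) : ℝ) ^ (1 + 2 * ε) ≤ Z)
    {Ω : Type*} [MeasurableSpace Ω] {μ : Measure Ω} {X : ℕ → Ω → V} {u : V}
    (hX : IsLazyWalk G u μ X) (v : V) :
    ∫⁻ ω, hitTime X v ω ∂μ ≤ ENNReal.ofReal
      ((2 * C + 2) * Fintype.card V * (2 * (2 * C + 3 + C * Z))) := by
  set N := Fintype.card V with hN
  have hn : (1 : ℝ) ≤ N := by exact_mod_cast Fintype.card_pos
  have hn0 : (0 : ℝ) < N := by linarith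
  set m := ⌈2 * C * N⌉₊ with hm
  have hm1 : 2 * C * N ≤ m := Nat.le_ceil _
  have hm2 : (m : ℝ) ≤ 2 * C * N + 1 := (Nat.ceil_lt_add_one (by positivity)).le
  have hLle : ((m + N : ℕ) : ℝ) ≤ (2 * C + 2) * N := by push_cast; nlinarith
  set S := 2 * C + 3 + C * Z with hS
  have hSpos : 0 < S := by positivity
  have hret : ∀ s, 1 + expVisits G v (m + N) s v ≤ S := by
    intro s
    have h1 : expVisits G v (m + N) s v ≤ ∑ t ∈ Finset.range (m + N),
        (1 / (N : ℝ) + C * (1 / ((t + 1 : ℕ) : ℝ) ^ (1 + 2 * ε))) := by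
      refine Finset.sum_le_sum fun t _ => ?_
      have := (abs_le.1 (hpt s (t + 1) (by omega) v v)).2
      rw [mul_one_div]
      linarith
    rw [Finset.sum_add_distrib, ← Finset.mul_sum, Finset.sum_const, Finset.card_range,
      nsmul_eq_mul] at h1
    have h2 : ((m + N : ℕ) : ℝ) * (1 / (N : ℝ)) ≤ 2 * C + 2 := by
      rw [mul_one_div, div_le_iff₀ hn0]; exact hLle
    have h3 := mul_le_mul_of_nonneg_left (hZ (m + N) hLle) (show 0 ≤ C by linarith)
    linarith
  have hvis : ∀ s y, 1 / 2 ≤ expVisits G v (m + N) s y := by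
    intro s y
    rw [expVisits, Finset.sum_range_add]
    have h1 : 0 ≤ ∑ t ∈ Finset.range m, transProb (fun i => G (s + i)) (t + 1) y v :=
      Finset.sum_nonneg fun t _ => transProb_nonneg (hG.comp fun i => s + i) _ _ _
    have h2 : ∑ t ∈ Finset.range N, 1 / (2 * (N : ℝ)) ≤
        ∑ t ∈ Finset.range N, transProb (fun i => G (s + i)) (m + t + 1) y v := by
      refine Finset.sum_le_sum fun t _ => ?_
      have h3 := (abs_le.1 (hpt s (m + t + 1) (by omega) y v)).1
      have h4 : C / ((m + t + 1 : ℕ) : ℝ) ^ (1 + 2 * ε) ≤ 1 / (2 * (N : ℝ)) := by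
        have h5 : (1 : ℝ) ≤ ((m + t + 1 : ℕ) : ℝ) := by exact_mod_cast Nat.le_add_left 1 (m + t)
        have h6 : (m : ℝ) ≤ ((m + t + 1 : ℕ) : ℝ) := by
          exact_mod_cast (by omega : m ≤ m + t + 1)
        have h7 : ((m + t + 1 : ℕ) : ℝ) ≤ ((m + t + 1 : ℕ) : ℝ) ^ (1 + 2 * ε) := by
          conv_lhs => rw [← Real.rpow_one ((m + t + 1 : ℕ) : ℝ)]
          exact Real.rpow_le_rpow_of_exponent_le h5 (by linarith)
        rw [div_le_div_iff₀ (by linarith) (by positivity)]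
        linarith
      have h8 : 1 / (N : ℝ) = 1 / (2 * (N : ℝ)) + 1 / (2 * (N : ℝ)) := by field_simp; norm_num
      linarith
    have h9 : ∑ t ∈ Finset.range N, 1 / (2 * (N : ℝ)) = 1 / 2 := by
      rw [Finset.sum_const, Finset.card_range, nsmul_eq_mul]; field_simp
    linarith
  have hav : ∀ s z, avoidProb G v (m + N) s z ≤ 1 - 1 / (2 * S) := by
    intro s z
    have h1 := (hvis s z).trans (expVisits_le hG hret le_rfl s z)
    have h2 : 1 / (2 * S) ≤ 1 - avoidProb G v (m + N) s z := by
      rw [div_le_iff₀ (by positivity)]; linarith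
    linarith
  refine lintegral_hitTime_le hG hX v fun K =>
    (sum_avoidProb_le hG (by positivity) hav K 0 u).trans ?_
  rw [div_div_eq_mul_div, div_one]
  exact mul_le_mul_of_nonneg_right hLle (by positivity)

end HittingTime

end EvolvingGraph

theorem theorem2 (Δ : ℕ) (c : ℝ) (hc : 0 < c) :
    -- mixing time and `t`-step probabilities
    (∃ C : ℝ, 0 < C ∧ ∀ ε : ℝ, 0 ≤ ε → ε ≤ 1 / 4 →
      ∀ n : ℕ, 2 ≤ n → ∀ G : ℕ → SimpleGraph (Fin n),
        EvolvingGraph.IsRegularBounded Δ G → EvolvingGraph.IsIsoperimetric c ε G →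
          ((EvolvingGraph.mixedTimes (EvolvingGraph.unif (Fin n)) G).Nonempty ∧
            (EvolvingGraph.mixingTime (EvolvingGraph.unif (Fin n)) G : ℝ)
              ≤ C * (n : ℝ) ^ (1 - 2 * ε)) ∧
          (∀ t : ℕ, 1 ≤ t → ∀ u v : Fin n,
            |EvolvingGraph.transProb G t u v - 1 / (n : ℝ)| ≤ C / (t : ℝ) ^ (1 + 2 * ε))) ∧
    -- maximum hitting time, `ε > 0`
    (∀ ε : ℝ, 0 < ε → ε ≤ 1 / 4 → ∃ C : ℝ, 0 < C ∧
      ∀ n : ℕ, 2 ≤ n → ∀ G : ℕ → SimpleGraph (Fin n),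
        EvolvingGraph.IsRegularBounded Δ G → EvolvingGraph.IsIsoperimetric c ε G →
          ∀ (Ω : Type*) [MeasurableSpace Ω] (μ : MeasureTheory.Measure Ω)
            [MeasureTheory.IsProbabilityMeasure μ] (X : ℕ → Ω → Fin n) (u v : Fin n),
            EvolvingGraph.IsLazyWalk G u μ X →
              ∫⁻ ω, EvolvingGraph.hitTime X v ω ∂μ ≤ ENNReal.ofReal (C * n)) ∧
    -- maximum hitting time, `ε = 0`
    (∃ C : ℝ, 0 < C ∧
      ∀ n : ℕ, 2 ≤ n → ∀ G : ℕ → SimpleGraph (Fin n),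
        EvolvingGraph.IsRegularBounded Δ G → EvolvingGraph.IsIsoperimetric c 0 G →
          ∀ (Ω : Type*) [MeasurableSpace Ω] (μ : MeasureTheory.Measure Ω)
            [MeasureTheory.IsProbabilityMeasure μ] (X : ℕ → Ω → Fin n) (u v : Fin n),
            EvolvingGraph.IsLazyWalk G u μ X →
              ∫⁻ ω, EvolvingGraph.hitTime X v ω ∂μ
                ≤ ENNReal.ofReal (C * (n * Real.log n))) := by
  set κ : ℝ := c / (2 * (Δ + 1)) with hκdef
  have hκ : 0 < κ := by positivity
  set K : ℝ := (384 / κ ^ 2 + 1) ^ 2 with hK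
  have hK1 : 1 ≤ K := by
    have : 0 ≤ 384 / κ ^ 2 := by positivity
    rw [hK]; nlinarith
  have hgood : ∀ ε : ℝ, ∀ n : ℕ, 2 ≤ n → ∀ G : ℕ → SimpleGraph (Fin n),
      EvolvingGraph.IsRegularBounded Δ G → EvolvingGraph.IsIsoperimetric c ε G →
        EvolvingGraph.IsGood κ ε G := fun ε n hn G hr hi =>
    EvolvingGraph.isGood_of_isoperimetric hc (by simpa using hn) hr hi
  refine ⟨⟨K + (1152 / κ ^ 2 + 1), by positivity, ?_⟩, ?_, ?_⟩
  · intro ε hε0 hε n hn G hr hi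
    have : NeZero n := ⟨by omega⟩
    have hG := hgood ε n hn G hr hi
    refine ⟨?_, ?_⟩
    · obtain ⟨t, ht, hle⟩ := EvolvingGraph.exists_mixed hG hκ hε0 hε
      refine ⟨⟨t, ht⟩, ?_⟩
      have h1 : EvolvingGraph.mixingTime (EvolvingGraph.unif (Fin n)) G ≤ t := Nat.sInf_le ht
      have h2 : (EvolvingGraph.mixingTime (EvolvingGraph.unif (Fin n)) G : ℝ) ≤ t := by
        exact_mod_cast h1
      rw [Fintype.card_fin] at hle
      refine (h2.trans hle).trans (mul_le_mul_of_nonneg_right ?_ (by positivity))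
      linarith
    · intro t ht u v
      have h1 := EvolvingGraph.abs_transProb_sub_le hG hκ hε0 hε ht u v
      rw [Fintype.card_fin] at h1
      refine h1.trans (div_le_div_of_nonneg_right ?_ (by positivity))
      have : 0 < 1152 / κ ^ 2 + 1 := by positivity
      linarith
  · intro ε hε0 hε
    have hsum : Summable fun t : ℕ => 1 / ((t + 1 : ℕ) : ℝ) ^ (1 + 2 * ε) :=
      (summable_nat_add_iff 1).2 (Real.summable_one_div_nat_rpow.2 (by linarith))
    set Z := ∑' t : ℕ, 1 / ((t + 1 : ℕ) : ℝ) ^ (1 + 2 * ε) with hZ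
    have hZ0 : 0 ≤ Z := tsum_nonneg fun t => by positivity
    refine ⟨(2 * K + 2) * (2 * (2 * K + 3 + K * Z)), by positivity, ?_⟩
    intro n hn G hr hi Ω _ μ _ X u v hX
    have : NeZero n := ⟨by omega⟩
    have hG := hgood ε n hn G hr hi
    refine (EvolvingGraph.lintegral_hitTime_le_of_pointwise hG hε0.le hK1 hZ0
      (fun s t ht x y => EvolvingGraph.abs_transProb_sub_le (hG.comp fun i => s + i)
        hκ hε0.le hε ht x y)
      (fun L _ => hsum.sum_le_tsum _ fun t _ => by positivity) hX v).trans (le_of_eq ?_)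
    rw [Fintype.card_fin]
    congr 1
    ring
  · set b := 1 + Real.log (2 * K + 2) with hb
    have hb0 : 0 ≤ b := by
      have := Real.log_nonneg (show 1 ≤ 2 * K + 2 by linarith)
      linarith
    have hlog2 : 0 < Real.log 2 := Real.log_pos (by norm_num)
    refine ⟨(2 * K + 2) * (2 * ((2 * K + 3 + K * b) / Real.log 2 + K)), by positivity, ?_⟩
    intro n hn G hr hi Ω _ μ _ X u v hX
    have : NeZero n := ⟨by omega⟩
    have hG := hgood 0 n hn G hr hi
    have hn2 : (2 : ℝ) ≤ n := by exact_mod_cast hn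
    have hlog : Real.log 2 ≤ Real.log n := Real.log_le_log (by norm_num) hn2
    have hZ : ∀ L : ℕ, (L : ℝ) ≤ (2 * K + 2) * (Fintype.card (Fin n) : ℝ) →
        ∑ t ∈ Finset.range L, 1 / ((t + 1 : ℕ) : ℝ) ^ (1 + 2 * (0 : ℝ)) ≤ b + Real.log n := by
      intro L hL
      have h1 : ∑ t ∈ Finset.range L, 1 / ((t + 1 : ℕ) : ℝ) ^ (1 + 2 * (0 : ℝ)) =
          ((harmonic L : ℚ) : ℝ) := by
        simp [harmonic]
      rw [h1]
      refine (harmonic_le_one_add_log L).trans ?_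
      rw [Fintype.card_fin] at hL
      have h2 : Real.log ((2 * K + 2) * n) = Real.log (2 * K + 2) + Real.log n :=
        Real.log_mul (by positivity) (by positivity)
      rcases Nat.eq_zero_or_pos L with h0 | h0
      · rw [h0, Nat.cast_zero, Real.log_zero]
        linarith [Real.log_nonneg (show 1 ≤ 2 * K + 2 by linarith)]
      · have := Real.log_le_log (by exact_mod_cast h0) hL
        linarith
    refine (EvolvingGraph.lintegral_hitTime_le_of_pointwise hG le_rfl hK1 (by linarith)
      (fun s t ht x y => EvolvingGraph.abs_transProb_sub_le (hG.comp fun i => s + i)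
        hκ le_rfl (by norm_num) ht x y) hZ hX v).trans (ENNReal.ofReal_le_ofReal ?_)
    rw [Fintype.card_fin]
    -- constants are absorbed using `log n ≥ log 2`
    have h3 : 2 * K + 3 + K * b ≤ (2 * K + 3 + K * b) / Real.log 2 * Real.log n := by
      rw [div_mul_eq_mul_div, le_div_iff₀ hlog2]
      exact mul_le_mul_of_nonneg_left hlog (by positivity)
    have h4 : 2 * K + 3 + K * (b + Real.log n) ≤
        ((2 * K + 3 + K * b) / Real.log 2 + K) * Real.log n := by
      rw [add_mul]; linarith
    have h5 : (0 : ℝ) ≤ (2 * K + 2) * n * 2 := by positivity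
    have := mul_le_mul_of_nonneg_left h4 h5
    linarith
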